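/- Let $\Sigma$ be a finite nonempty alphabet with a fixed (arbitrary) padding symbol $\Box\in\Sigma$. For $n\in\mathbb N$ and a stream $x\in\Sigma^*$ let $\mathrm{last}_n(x)$ be the suffix of length $n$ of $x$ if $|x|\ge n$, and $\Box^{\,n-|x|}x$ otherwise; for $L\subseteq\Sigma^*$ put $\mathrm{SW}_n(L)=\{x\in\Sigma^* : \mathrm{last}_n(x)\in L\}$. A randomized streaming algorithm over $\Sigma$ is a probabilistic automaton $P=(Q,\Sigma,\iota,\rho,F)$ with a nonempty, possibly infinite, state set $Q$, an initial distribution $\iota$ on $Q$, transition distributions $\rho(p,a,\cdot)$ on $Q$ for $p\in Q$, $a\in\Sigma$, and final states $F\subseteq Q$. It accepts $w$ with the probability that its state after reading $w$ lies in $F$, and otherwise rejects $w$; its space is $\log_2|Q|\in[0,\infty]$. It is true-biased for a language $K$ if it accepts every $w\in K$ with probability at least $2/3$ and rejects every $w\notin K$ with probability $1$; it is false-biased for $K$ if it accepts every $w\in K$ with probability $1$ and rejects every $w\notin K$ with probability at least $2/3$. Let $F^{\mathsf 0}_L(n)$ (resp. $F^{\mathsf 1}_L(n)$) be the minimal space of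 a true-biased (resp. false-biased) algorithm for $\mathrm{SW}_n(L)$. A nondeterministic sliding-window algorithm for $L$ and window size $n$ is a nondeterministic finite automaton (possibly with several initial states) accepting exactly $\mathrm{SW}_n(L)$. Let $\mathbf{Len}$ be the class of regular languages $K\subseteq\Sigma^*$ such that for every $n\ge 0$ either $\Sigma^n\subseteq K$ or $\Sigma^n\cap K=\emptyset$; let $\mathbf{ST}$ be the class of finite Boolean combinations of languages $\Sigma^*w$ with $w\in\Sigma^*$; let $\mathbf{LI}$ be the class of languages $\Sigma^*K$ with $K\subseteq\Sigma^*$ regular. For classes $\mathbf A,\mathbf B$ let $\langle\mathbf A,\mathbf B\rangle$ be the class of finite Boolean combinations of members of $\mathbf A\cup\mathbf B$. Write $f(n)=\bar\Omega(g(n))$ if there is $c>0$ with $f(n)\ge c\,g(n)$ for infinitely many $n$. **Theorem.** Let $L\subseteq\Sigma^*$ be regular. 1. If $L\in\langle\mathbf{ST},\mathbf{Len}\rangle$, then $F^{\mathsf 0}_L(n)$ and $F^{\mathsf 1}_L(n)$ are $O(1)$. 2. If $L\notin\langle\mathbf{ST},\mathbf{Len}\rangle$, then $F^{\mathsf 0}_L(n)$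 and $F^{\mathsf 1}_L(n)$ are $\bar\Omega(\log n)$. 3. If $L\in\langle\mathbf{LI},\mathbf{Len}\rangle$, then $F^{\mathsf 0}_L(n)$ and $F^{\mathsf 1}_L(n)$ are $O(\log n)$. 4. If $L\notin\langle\mathbf{LI},\mathbf{Len}\rangle$, then $F^{\mathsf 0}_L(n)$ and $F^{\mathsf 1}_L(n)$ are $\bar\Omega(n)$. 5. If $L\notin\langle\mathbf{ST},\mathbf{Len}\rangle$, then there is $c>0$ such that for infinitely many $n$ every nondeterministic sliding-window algorithm for $L$ and window size $n$ has at least $c\sqrt n$ states. -/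

import Mathlib

open Filter
open scoped ENNReal

namespace SlidingWindow

section Windows

variable {α : Type*}

/-- The window of length `n`: the suffix of `x` of length `n`, padded on the left with the
symbol `pad` if `x` is shorter than `n`. -/
def lastWindow (pad : α) (n : ℕ) (x : List α) : List α :=
  if n ≤ x.length then x.drop (x.length - n) else List.replicate (n - x.length) pad ++ x

/-- The sliding window problem of `L` for window length `n`: all streams whose window of
length `n` belongs to `L`. -/
def SW (pad : α) (L : Language α) (n : ℕ) : Language α :=
  {x : List α | lastWindow pad n x ∈ L}

end Windows

section LanguageClasses

variable (α : Type*)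

/-- Suffix-testable languages: finite Boolean combinations of languages `Σ* w`. -/
def SuffixTestable : Set (Language α) :=
  {L | L ∈ BooleanSubalgebra.closure
    {K : Language α | ∃ w : List α, K = (⊤ : Language α) * ({w} : Language α)}}

/-- Regular length languages: for each `n`, all words of length `n` belong to `L`, or none. -/
def RegularLength : Set (Language α) :=
  {L | L.IsRegular ∧ ∀ n : ℕ,
    (∀ w : List α, w.length = n → w ∈ L) ∨ (∀ w : List α, w.length = n → w ∉ L)}

/-- Regular left ideals: languages `Σ* K` with `K` regular. -/
def RegularLeftIdeal : Set (Language α) :=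
  {L | ∃ K : Language α, K.IsRegular ∧ L = (⊤ : Language α) * K}

/-- Finite Boolean combinations of suffix-testable languages and regular length languages. -/
def STLen : Set (Language α) :=
  {L | L ∈ BooleanSubalgebra.closure (SuffixTestable α ∪ RegularLength α)}

/-- Finite Boolean combinations of regular left ideals and regular length languages. -/
def LILen : Set (Language α) :=
  {L | L ∈ BooleanSubalgebra.closure (RegularLeftIdeal α ∪ RegularLength α)}

end LanguageClasses

/-- A randomized streaming algorithm (probabilistic automaton) over the alphabet `α` with set of
memory states `Q`, which may be infinite. -/
structure RandomizedAlgorithm (α : Type*) (Q : Type*) where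
  /-- initial state distribution -/
  init : PMF Q
  /-- transition probabilities -/
  step : Q → α → PMF Q
  /-- final states -/
  accept : Set Q

namespace RandomizedAlgorithm

variable {α Q : Type*} (P : RandomizedAlgorithm α Q)

/-- The distribution of the memory state after reading `w`. -/
noncomputable def run (w : List α) : PMF Q :=
  w.foldl (fun X a => X.bind fun p => P.step p a) P.init

/-- The probability that `w` is accepted. -/
noncomputable def acceptProb (w : List α) : ℝ≥0∞ :=
  (P.run w).toOuterMeasure P.accept

/-- The probability that `w` is rejected. -/
noncomputable def rejectProb (w : List α) : ℝ≥0∞ :=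
  (P.run w).toOuterMeasure P.acceptᶜ

/-- `P` is a true-biased streaming algorithm for the language `K`. -/
def IsTrueBiasedFor (K : Language α) : Prop :=
  ∀ w : List α, (w ∈ K → 2 / 3 ≤ P.acceptProb w) ∧ (w ∉ K → P.rejectProb w = 1)

/-- `P` is a false-biased streaming algorithm for the language `K`. -/
def IsFalseBiasedFor (K : Language α) : Prop :=
  ∀ w : List α, (w ∈ K → P.acceptProb w = 1) ∧ (w ∉ K → 2 / 3 ≤ P.rejectProb w)

end RandomizedAlgorithm

open Classical in
/-- The space, in bits, used by a streaming algorithm with set of memory states `Q`: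
`log₂ |Q|`, which is `∞` if `Q` is infinite. -/
noncomputable def space (Q : Type*) : ℝ≥0∞ :=
  if Finite Q then ENNReal.ofReal (Real.logb 2 (Nat.card Q)) else ⊤

/-- The minimal space of a true-biased sliding window algorithm for `L` and window length `n`. -/
noncomputable def trueBiasedComplexity {α : Type*} (pad : α) (L : Language α) (n : ℕ) : ℝ≥0∞ :=
  ⨅ (Q : Type) (P : RandomizedAlgorithm α Q) (_ : P.IsTrueBiasedFor (SW pad L n)), space Q

/-- The minimal space of a false-biased sliding window algorithm for `L` and window length `n`. -/
noncomputable def falseBiasedComplexity {α : Type*} (pad : α) (L : Language α) (n : ℕ) : ℝ≥0∞ :=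
  ⨅ (Q : Type) (P : RandomizedAlgorithm α Q) (_ : P.IsFalseBiasedFor (SW pad L n)), space Q

/-- `f(n) = O(g(n))`; in particular `f(n)` is finite for all large `n`. -/
def BigO (f : ℕ → ℝ≥0∞) (g : ℕ → ℝ) : Prop :=
  ∃ C : ℝ, ∀ᶠ n in atTop, f n ≤ ENNReal.ofReal (C * g n)

/-- `f(n) = Ω̄(g(n))`: for some `c > 0`, `f(n) ≥ c g(n)` for infinitely many `n`. -/
def BigOmegaInf (f : ℕ → ℝ≥0∞) (g : ℕ → ℝ) : Prop :=
  ∃ c : ℝ, 0 < c ∧ ∃ᶠ n in atTop, ENNReal.ofReal (c * g n) ≤ f n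

end SlidingWindow

/-! Upper bounds are deterministic. Languages whose window problems have automata with at most `g n
^ C` states form a Boolean algebra, by products and complements. With `g = 2` it contains `Σ* u` and
the length languages. With `g n = n + 2` it contains the regular left ideals: it suffices to
remember, for each state of an automaton for `K`, the length of the shortest suffix leading to it,
capped at `n + 1`.

Lower bounds are needed only for true bias, since complementing an algorithm exchanges the biases
and both classes are closed under complement. Each bound starts from an automaton reading `L` from
right to left.

Outside `⟨ST, Len⟩` there are `x`, `y` of equal length and a pumpable `z` with `x z^i w ∈ L` and `y
z^i w ∉ L` for all `i` (`exists_pumping_of_notMem_STLen`). For a suitable window length the initial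
word matters after `m` copies of `z` and is forgotten after more. A nondeterministic automaton with
`k` states cannot tell these apart once `m ≥ 2 k ^ 2`, because walk lengths can be changed by cycles
(`Walk.of_long`). The support of a true-biased algorithm is such an automaton, so the square root
bound on states gives the logarithmic bound on space.

Outside `⟨LI, Len⟩` some state has two return loops with prefixes of equal length, one accepted and
one rejected (`mem_LILen_of_rightDFA`). These loops give blocks that encode arbitrary bits, and
sliding the window reads any one of them. This solves the index problem with one-sided error, which
takes exponentially many messages (`two_pow_le_card_of_index`). -/

namespace SlidingWindow

/-! ### Witnesses for non-membership in the two language classes -/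

section Structure

variable {α : Type*}

/-- A language is a Boolean combination of any finite family of languages that separates its
words from all other words. -/
theorem mem_of_separating {ι : Type*} [Finite ι] (B : BooleanSubalgebra (Language α))
    (K : ι → Language α) (hK : ∀ i, K i ∈ B) (L : Language α)
    (h : ∀ w w' : List α, (∀ i, w ∈ K i ↔ w' ∈ K i) → w ∈ L → w' ∈ L) : L ∈ B := by
  classical
  let atom : Set ι → Language α := fun s => ⨅ i, if i ∈ s then K i else (K i)ᶜ
  have hmem : ∀ (s : Set ι) (w : List α), w ∈ atom s ↔ ∀ i, w ∈ K i ↔ i ∈ s := by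
    intro s w
    have h1 : w ∈ atom s ↔ ∀ i, w ∈ (if i ∈ s then K i else (K i)ᶜ) := Set.mem_iInter
    rw [h1]
    refine forall_congr' fun i => ?_
    by_cases hi : i ∈ s
    · simp [hi]
    · simp only [hi, if_false, iff_false]
      exact Iff.rfl
  have hatom : ∀ s, atom s ∈ B := fun s => BooleanSubalgebra.iInf_mem fun i => by
    split_ifs
    · exact hK i
    · exact BooleanSubalgebra.compl_mem (hK i)
  -- `L` is the union of the finitely many atoms that it meets.
  have hL : L = ⨆ s : {s : Set ι // ∃ w ∈ L, w ∈ atom s}, atom s.1 := by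
    ext w
    have h1 : w ∈ (⨆ s : {s : Set ι // ∃ w ∈ L, w ∈ atom s}, atom s.1) ↔
      ∃ s : {s : Set ι // ∃ w ∈ L, w ∈ atom s}, w ∈ atom s.1 := Set.mem_iUnion
    rw [h1]
    constructor
    · intro hw
      have : w ∈ atom {i | w ∈ K i} := (hmem _ _).2 fun i => Iff.rfl
      exact ⟨⟨_, w, hw, this⟩, this⟩
    · rintro ⟨⟨s, v, hv, hvs⟩, hws⟩
      refine h v w (fun i => ?_) hv
      rw [(hmem s v).1 hvs i, (hmem s w).1 hws i]
  rw [hL]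
  exact BooleanSubalgebra.iSup_mem fun s => hatom _

theorem mem_top_mul {K : Language α} {w : List α} :
    w ∈ (⊤ : Language α) * K ↔ ∃ x y, y ∈ K ∧ x ++ y = w := by
  rw [Language.mem_mul]
  constructor
  · rintro ⟨a, -, b, hb, h⟩
    exact ⟨a, b, hb, h⟩
  · rintro ⟨a, b, hb, h⟩
    exact ⟨a, Set.mem_univ _, b, hb, h⟩

theorem mem_top_mul_singleton {u w : List α} :
    w ∈ (⊤ : Language α) * ({u} : Language α) ↔ u <:+ w := by
  rw [mem_top_mul]
  constructor
  · rintro ⟨x, y, hy, rfl⟩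
    obtain rfl : y = u := hy
    exact List.suffix_append _ _
  · rintro ⟨x, rfl⟩
    exact ⟨x, u, rfl, rfl⟩

/-- The language of all words of length congruent to `r` modulo `N` is a regular length
language. -/
theorem lengthMod_regularLength (N : ℕ) [NeZero N] (r : ZMod N) :
    ({w : List α | (w.length : ZMod N) = r} : Language α) ∈ RegularLength α := by
  constructor
  · refine Language.isRegular_iff.2 ⟨ZMod N, inferInstance, ⟨fun s _ => s + 1, 0, {r}⟩, ?_⟩
    ext w
    rw [DFA.mem_accepts]
    have : ∀ w : List α, (⟨fun s _ => s + 1, 0, {r}⟩ : DFA α (ZMod N)).eval w = w.length := by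
      intro w
      induction w using List.reverseRecOn with
      | nil => simp
      | append_singleton x a ih => rw [DFA.eval_append_singleton, ih]; simp
    rw [this]
    exact Iff.rfl
  · intro n
    by_cases h : (n : ZMod N) = r
    · exact Or.inl fun w hw => by subst hw; exact h
    · exact Or.inr fun w hw => by subst hw; exact h

/-- The words that have the length of some word of a regular language form a regular length
language. -/
theorem sameLength_regularLength {K : Language α} (hK : K.IsRegular) :
    ({w : List α | ∃ x ∈ K, x.length = w.length} : Language α) ∈ RegularLength α := by
  classical
  constructor
  · obtain ⟨σ, _, M, rfl⟩ := hK
    -- The subset automaton forgets the letters: it tracks all states reachable by words of the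
    -- current length.
    let M' : DFA α (Set σ) :=
      ⟨fun S _ => {q | ∃ p ∈ S, ∃ b, q = M.step p b}, {M.start}, {S | ∃ q ∈ S, q ∈ M.accept}⟩
    refine Language.isRegular_iff.2 ⟨Set σ, inferInstance, M', ?_⟩
    have hev : ∀ w : List α, M'.eval w = {q | ∃ x : List α, x.length = w.length ∧ M.eval x = q} := by
      intro w
      induction w using List.reverseRecOn with
      | nil =>
        ext q
        simp [M', eq_comm]
      | append_singleton x a ih =>
        rw [DFA.eval_append_singleton, ih]
        ext q
        constructor
        · rintro ⟨p, ⟨y, hy, rfl⟩, b, rfl⟩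
          exact ⟨y ++ [b], by simp [hy], by simp⟩
        · rintro ⟨y, hy, rfl⟩
          rcases List.eq_nil_or_concat y with rfl | ⟨y, b, rfl⟩
          · simp at hy
          · simp only [List.concat_eq_append] at hy ⊢
            exact ⟨M.eval y, ⟨y, by simpa using hy, rfl⟩, b, by simp⟩
    ext w
    rw [DFA.mem_accepts, hev]
    constructor
    · rintro ⟨q, ⟨x, hx, rfl⟩, hq⟩
      exact ⟨x, hq, hx⟩
    · rintro ⟨x, hx, hl⟩
      exact ⟨_, ⟨x, hl, rfl⟩, hx⟩
  · intro n
    by_cases h : ∃ x ∈ K, x.length = n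
    · exact Or.inl fun w hw => by subst hw; exact h
    · exact Or.inr fun w hw => by subst hw; exact h

/-- The left quotient by `x` depends only on which prefixes of `u` are suffixes of `x`, so there are
finitely many quotients. -/
theorem top_mul_singleton_isRegular (u : List α) :
    ((⊤ : Language α) * ({u} : Language α)).IsRegular := by
  apply Language.IsRegular.of_finite_range_leftQuotient
  classical
  let G : Set (List α) → Language α := fun S => {y | u <:+ y ∨ ∃ s ∈ S, u = s ++ y}
  refine Set.Finite.subset
    (Set.Finite.image G ((List.finite_toSet u.inits).finite_subsets)) ?_
  rintro _ ⟨x, rfl⟩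
  refine ⟨{s | s ∈ u.inits ∧ s <:+ x}, fun s hs => hs.1, ?_⟩
  ext y
  rw [Language.mem_leftQuotient, mem_top_mul_singleton]
  constructor
  · rintro (h | ⟨s, ⟨-, hs⟩, rfl⟩)
    · exact h.trans (List.suffix_append _ _)
    · obtain ⟨t, rfl⟩ := hs
      exact ⟨t, by simp⟩
  · intro h
    by_cases hl : u.length ≤ y.length
    · exact Or.inl (List.suffix_of_suffix_length_le h (List.suffix_append _ _) hl)
    · obtain ⟨s, rfl⟩ : y <:+ u :=
        List.suffix_of_suffix_length_le (List.suffix_append _ _) h (by omega)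
      refine Or.inr ⟨s, ⟨by simp, ?_⟩, rfl⟩
      obtain ⟨t, ht⟩ := h
      rw [← List.append_assoc] at ht
      exact ⟨t, List.append_cancel_right ht⟩

theorem eval_append {σ : Type*} (M : DFA α σ) (x y : List α) :
    M.eval (x ++ y) = M.evalFrom (M.eval x) y :=
  M.evalFrom_of_append _ _ _

theorem exists_rightDFA {L : Language α} (hL : L.IsRegular) :
    ∃ (Q : Type) (_ : Fintype Q) (M : DFA α Q), ∀ w, w ∈ L ↔ M.eval w.reverse ∈ M.accept := by
  obtain ⟨Q, hQ, M, hM⟩ := hL.reverse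
  refine ⟨Q, hQ, M, fun w => ?_⟩
  rw [← DFA.mem_accepts, hM, Language.mem_reverse, List.reverse_reverse]

/-- A regular language whose words of each length are determined by a suffix of bounded length is
a Boolean combination of suffix-testable and regular length languages. -/
theorem mem_STLen_of_suffix [Finite α] {L : Language α} (hL : L.IsRegular) (k : ℕ)
    (h : ∀ x y u : List α, x.length = y.length → u.length = k → x ++ u ∈ L → y ++ u ∈ L) :
    L ∈ STLen α := by
  have hfin : Finite {u : List α // u.length ≤ k} := List.finite_length_le α k
  refine mem_of_separating (BooleanSubalgebra.closure (SuffixTestable α ∪ RegularLength α))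
    (Sum.elim (fun u : {u : List α // u.length ≤ k} => (⊤ : Language α) * ({u.1} : Language α))
      (fun u : {u : List α // u.length ≤ k} =>
        {w | ∃ x ∈ L ⊓ (⊤ : Language α) * ({u.1} : Language α), x.length = w.length})) ?_ L ?_
  · rintro (u | u)
    · exact BooleanSubalgebra.mem_closure_of_mem
        (Or.inl (BooleanSubalgebra.mem_closure_of_mem ⟨u.1, rfl⟩))
    · exact BooleanSubalgebra.mem_closure_of_mem
        (Or.inr (sameLength_regularLength (hL.inf (top_mul_singleton_isRegular _))))
  · intro w w' hw hwL
    have h1 : ∀ u : List α, u.length ≤ k → (u <:+ w ↔ u <:+ w') := by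
      intro u hu
      rw [← mem_top_mul_singleton, ← mem_top_mul_singleton]
      exact hw (Sum.inl ⟨u, hu⟩)
    rcases le_or_gt k w.length with hk | hk
    · obtain ⟨u, hu, x, rfl⟩ : ∃ u : List α, u.length = k ∧ u <:+ w :=
        ⟨w.drop (w.length - k), by simp; omega, List.drop_suffix _ _⟩
      obtain ⟨y, rfl⟩ := (h1 u hu.le).1 (List.suffix_append _ _)
      -- `w` witnesses its own length, so some word of `L` with suffix `u` is as long as `w'`; the
      -- hypothesis `h` transfers membership.
      obtain ⟨v, ⟨hvL, hv⟩, hl⟩ := (hw (Sum.inr ⟨u, hu.le⟩)).1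
        ⟨x ++ u, ⟨hwL, mem_top_mul_singleton.2 (List.suffix_append _ _)⟩, rfl⟩
      obtain ⟨x', rfl⟩ := mem_top_mul_singleton.1 hv
      exact h x' y u (by simpa using hl) hu hvL
    · obtain ⟨x, rfl⟩ := (h1 w hk.le).1 (List.suffix_refl _)
      rcases List.eq_nil_or_concat x with rfl | ⟨x, a, rfl⟩
      · simpa using hwL
      -- As `w` is shorter than `k`, a suffix one letter longer is still tested; hence `w' = w`.
      · have := (h1 (a :: w) (by simpa using hk)).2 ⟨x, by simp⟩
        have := this.length_le
        simp at this

/-- A common suffix as long as the number of states makes the right-to-left run repeat a state, so a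
factor of it can be pumped whatever stands to its left. -/
theorem exists_pumping_of_notMem_STLen [Finite α] {L : Language α} (hL : L.IsRegular)
    (h : L ∉ STLen α) :
    ∃ x y z w : List α, x.length = y.length ∧ z ≠ [] ∧ x.length ≤ z.length ∧
      x ++ w ∈ L ∧ y ++ w ∉ L ∧
      ∀ i s, s ++ ((List.replicate i z).flatten ++ w) ∈ L ↔ s ++ w ∈ L := by
  obtain ⟨Q, _, M, hM⟩ := exists_rightDFA hL
  have h1 : ∃ x y u : List α, x.length = y.length ∧ u.length = Fintype.card Q ∧
      x ++ u ∈ L ∧ y ++ u ∉ L := by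
    by_contra! hc
    exact h (mem_STLen_of_suffix hL _ hc)
  obtain ⟨x, y, u, hxy, hu, hx, hy⟩ := h1
  obtain ⟨q, a, b, c, habc, -, hb, ha, hbq, -⟩ :=
    M.evalFrom_split (x := u.reverse) (s := M.start) (by simp [hu]) rfl
  have hu' : u = c.reverse ++ (b.reverse ++ a.reverse) := by
    rw [← List.reverse_reverse u, habc]; simp
  have key : ∀ s : List α, s ++ (b.reverse ++ a.reverse) ∈ L ↔ s ++ a.reverse ∈ L := by
    intro s
    rw [hM, hM]
    simp only [List.reverse_append, List.reverse_reverse, DFA.eval, DFA.evalFrom_of_append, ha,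
      hbq]
  have key2 : ∀ (i : ℕ) (s : List α),
      s ++ ((List.replicate i b.reverse).flatten ++ a.reverse) ∈ L ↔ s ++ a.reverse ∈ L := by
    intro i
    induction i with
    | zero => simp
    | succ i ih =>
      intro s
      rw [List.replicate_succ', List.flatten_append, List.flatten_singleton, List.append_assoc,
        ← List.append_assoc, key, List.append_assoc, ih]
  have hb' : 0 < b.length := List.length_pos_iff.2 hb
  -- The loop is repeated often enough that `z` is at least as long as the words in front of it.
  refine ⟨x ++ c.reverse, y ++ c.reverse,
    (List.replicate ((x ++ c.reverse).length + 1) b.reverse).flatten, a.reverse, by simp [hxy],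
    by rw [List.replicate_succ]; simp [hb], ?_, ?_, ?_, fun i => ?_⟩
  · simp only [List.length_flatten, List.map_replicate, List.sum_replicate, smul_eq_mul,
      List.length_reverse]
    nlinarith
  · rw [← key]
    simpa [hu'] using hx
  · rw [← key]
    simpa [hu'] using hy
  · induction i with
    | zero => simp
    | succ i ih =>
      intro s
      rw [List.replicate_succ', List.flatten_append, List.flatten_singleton, List.append_assoc,
        ← List.append_assoc, key2, List.append_assoc, ih]

/-- The hypothesis says that, inside a strongly connected component, acceptance depends only on the
start state and the distance travelled. The separating languages determine the component and that
distance modulo `N`. -/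
theorem mem_LILen_of_rightDFA {Q : Type} [Fintype Q] (M : DFA α Q) {L : Language α}
    (hM : ∀ w, w ∈ L ↔ M.eval w.reverse ∈ M.accept)
    (h : ∀ z u v s t : List α, u.length = v.length →
      M.eval (z ++ u ++ s) = M.eval z → M.eval (z ++ v ++ t) = M.eval z →
      M.eval (z ++ u) ∈ M.accept → M.eval (z ++ v) ∈ M.accept) :
    L ∈ LILen α := by
  classical
  have hloop : ∃ ℓ : Q → ℕ, (∀ q, ℓ q ≠ 0) ∧ ∀ q u, u ≠ [] → M.evalFrom q u = q →
      ∃ x : List α, x.length = ℓ q ∧ M.evalFrom q x = q := by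
    have : ∀ q, ∃ l : ℕ, l ≠ 0 ∧ ∀ u, u ≠ [] → M.evalFrom q u = q →
      ∃ x : List α, x.length = l ∧ M.evalFrom q x = q := by
      intro q
      by_cases hq : ∃ u, u ≠ [] ∧ M.evalFrom q u = q
      · obtain ⟨u, hu, huq⟩ := hq
        exact ⟨u.length, by simpa using hu, fun _ _ _ => ⟨u, rfl, huq⟩⟩
      · exact ⟨1, one_ne_zero, fun u hu huq => (hq ⟨u, hu, huq⟩).elim⟩
    choose ℓ h1 h2 using this
    exact ⟨ℓ, h1, h2⟩
  obtain ⟨ℓ, hℓ, hloop⟩ := hloop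
  obtain ⟨N, hN0, hN⟩ : ∃ N : ℕ, N ≠ 0 ∧ ∀ q, ℓ q ∣ N :=
    ⟨∏ q, ℓ q, Finset.prod_ne_zero_iff.2 fun q _ => hℓ q,
      fun q => Finset.dvd_prod_of_mem _ (Finset.mem_univ q)⟩
  have : NeZero N := ⟨hN0⟩
  have hloopN : ∀ q u, u ≠ [] → M.evalFrom q u = q → ∀ j, N ∣ j →
      ∃ x : List α, x.length = j ∧ M.evalFrom q x = q := by
    intro q u hu huq j hj
    obtain ⟨c, rfl⟩ := (hN q).trans hj
    obtain ⟨x, hx, hxq⟩ := hloop q u hu huq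
    clear hj
    induction c with
    | zero => exact ⟨[], by simp, rfl⟩
    | succ c ih =>
      obtain ⟨y, hy, hyq⟩ := ih
      exact ⟨x ++ y, by simp [hx, hy]; ring, by rw [DFA.evalFrom_of_append, hxq, hyq]⟩
  let V : Q × ZMod N → Language α :=
    fun qr => {s | s ∈ {w : List α | M.eval w.reverse = qr.1} ∧ (s.length : ZMod N) = qr.2}
  have hmemV : ∀ (q : Q) (r : ZMod N) (w : List α), w ∈ (⊤ : Language α) * V (q, r) ↔
      ∃ x y : List α, x ++ y = w ∧ M.eval y.reverse = q ∧ (y.length : ZMod N) = r := by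
    intro q r w
    rw [mem_top_mul]
    constructor
    · rintro ⟨x, y, hy, rfl⟩
      exact ⟨x, y, rfl, hy.1, hy.2⟩
    · rintro ⟨x, y, rfl, h1, h2⟩
      exact ⟨x, y, ⟨h1, h2⟩, rfl⟩
  have hV : ∀ qr, (V qr).IsRegular := by
    intro qr
    have h1 : Language.IsRegular (T := α) {w : List α | M.eval w.reverse = qr.1} := by
      apply Language.IsRegular.of_reverse
      refine ⟨Q, inferInstance, ⟨M.step, M.start, {qr.1}⟩, ?_⟩
      ext w
      change _ ↔ M.eval w.reverse.reverse = qr.1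
      rw [List.reverse_reverse]
      exact Iff.rfl
    exact h1.inf (lengthMod_regularLength N qr.2).1
  refine mem_of_separating (BooleanSubalgebra.closure (RegularLeftIdeal α ∪ RegularLength α))
    (Sum.elim (fun qr => (⊤ : Language α) * V qr)
      (fun r : ZMod N => {w : List α | (w.length : ZMod N) = r})) ?_ L ?_
  · rintro (qr | r)
    · exact BooleanSubalgebra.mem_closure_of_mem (Or.inl ⟨V qr, hV qr, rfl⟩)
    · exact BooleanSubalgebra.mem_closure_of_mem (Or.inr (lengthMod_regularLength N r))
  · intro w w' hw hwL
    have hlen : (w'.length : ZMod N) = w.length := (hw (Sum.inr _)).1 rfl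
    -- Each of `w`, `w'` has a suffix reaching the state of the other, so the two states lie in one
    -- strongly connected component.
    obtain ⟨x, y, rfl, hy, hyl⟩ := (hmemV _ _ _).1 <|
      (hw (Sum.inl (M.eval w.reverse, (w.length : ZMod N)))).1
        ((hmemV _ _ _).2 ⟨[], w, rfl, rfl, rfl⟩)
    obtain ⟨x', y', hxy', hy', -⟩ := (hmemV _ _ _).1 <|
      (hw (Sum.inl (M.eval (x ++ y).reverse, ((x ++ y).length : ZMod N)))).2
        ((hmemV _ _ _).2 ⟨[], x ++ y, rfl, rfl, rfl⟩)
    have hback : M.eval (y.reverse ++ x.reverse ++ x'.reverse) = M.eval y.reverse := by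
      rw [hy, ← List.reverse_append, eval_append, ← hy', ← eval_append, ← List.reverse_append,
        hxy']
    rw [hM, ← hy] at hwL
    rw [hM, List.reverse_append]
    by_cases hx : x = []
    · simpa [hx] using hwL
    -- Equal residues make `x.length` a multiple of `N`, so a loop of exactly this length exists at
    -- the state of `w`, and `h` compares it with `x.reverse`.
    · have hdvd : N ∣ x.length := by
        rw [← ZMod.natCast_eq_zero_iff]
        have := hlen
        rw [List.length_append, Nat.cast_add, hyl] at this
        simpa using this
      obtain ⟨v, hv, hvq⟩ := hloopN (M.eval y.reverse) (x.reverse ++ x'.reverse) (by simp [hx])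
        (by rw [← eval_append, ← List.append_assoc]; exact hback)
        x.length hdvd
      have hv' : M.eval (y.reverse ++ v) = M.eval y.reverse := by
        rw [eval_append]; exact hvq
      refine h y.reverse v x.reverse [] x'.reverse (by simp [hv]) (by simpa using hv') hback ?_
      rw [hv']
      exact hwL

/-- The concatenation of the words `X` (for `true`) and `Y` (for `false`) chosen by `bs`. -/
def blocks (X Y : List α) (bs : List Bool) : List α :=
  bs.flatMap fun b => if b then X else Y

theorem exists_blocks_of_notMem_LILen {L : Language α} (hL : L.IsRegular) (h : L ∉ LILen α) :
    ∃ X Y U V Z : List α, X.length = Y.length ∧ U.length = V.length ∧ U <:+ X ∧ V <:+ Y ∧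
      ∀ bs, U ++ (blocks X Y bs ++ Z) ∈ L ∧ V ++ (blocks X Y bs ++ Z) ∉ L := by
  obtain ⟨Q, _, M, hM⟩ := exists_rightDFA hL
  have h1 : ∃ z u v s t : List α, u.length = v.length ∧
      M.eval (z ++ u ++ s) = M.eval z ∧ M.eval (z ++ v ++ t) = M.eval z ∧
      M.eval (z ++ u) ∈ M.accept ∧ M.eval (z ++ v) ∉ M.accept := by
    by_contra! hc
    exact h (mem_LILen_of_rightDFA M hM hc)
  obtain ⟨z, u, v, s, t, huv, hu, hv, huA, hvA⟩ := h1
  -- Both blocks traverse both loops, in opposite orders: this equalizes their lengths, while the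
  -- suffixes `u.reverse` and `v.reverse` tell them apart.
  let X := (u ++ s ++ v ++ t).reverse
  let Y := (v ++ t ++ u ++ s).reverse
  have hu' : M.evalFrom (M.eval z) (u ++ s) = M.eval z := by
    rw [List.append_assoc] at hu
    rw [← eval_append]
    exact hu
  have hv' : M.evalFrom (M.eval z) (v ++ t) = M.eval z := by
    rw [List.append_assoc] at hv
    rw [← eval_append]
    exact hv
  have hX : M.evalFrom (M.eval z) X.reverse = M.eval z := by
    simp only [X, List.reverse_reverse]
    rw [List.append_assoc (u ++ s), DFA.evalFrom_of_append, hu', hv']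
  have hY : M.evalFrom (M.eval z) Y.reverse = M.eval z := by
    simp only [Y, List.reverse_reverse]
    rw [List.append_assoc (v ++ t), DFA.evalFrom_of_append, hv', hu']
  have hbs : ∀ bs, M.eval (blocks X Y bs ++ z.reverse).reverse = M.eval z := by
    intro bs
    induction bs with
    | nil => simp [blocks]
    | cons b bs ih =>
      have : blocks X Y (b :: bs) = (if b then X else Y) ++ blocks X Y bs := rfl
      rw [this, List.append_assoc, List.reverse_append, eval_append, ih]
      split_ifs
      · exact hX
      · exact hY
  refine ⟨X, Y, u.reverse, v.reverse, z.reverse, by simp [X, Y]; omega, by simpa using huv,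
    ⟨(s ++ v ++ t).reverse, by simp [X]⟩, ⟨(t ++ u ++ s).reverse, by simp [Y]⟩, fun bs => ?_⟩
  have key : ∀ u, M.eval (u.reverse ++ (blocks X Y bs ++ z.reverse)).reverse = M.eval (z ++ u) := by
    intro u
    rw [List.reverse_append, List.reverse_reverse, eval_append, hbs, ← eval_append]
  rw [hM, hM, key, key]
  exact ⟨huA, hvA⟩

end Structure

end SlidingWindow

namespace SlidingWindow

/-! ### Changing the length of walks in finite graphs -/

section Walks

variable {Q : Type*} (R : Q → Q → Prop)

/-- `Walk R n p q` means that there is a walk of length `n` from `p` to `q` in the graph `R`. -/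
def Walk : ℕ → Q → Q → Prop
  | 0, p, q => p = q
  | n + 1, p, q => ∃ r, Walk n p r ∧ R r q

variable {R}

theorem Walk.append {m n : ℕ} {p q r : Q} (h1 : Walk R m p q) (h2 : Walk R n q r) :
    Walk R (m + n) p r := by
  induction n generalizing r with
  | zero => obtain rfl : q = r := h2; exact h1
  | succ n ih =>
    obtain ⟨s, hs, hr⟩ := h2
    exact ⟨s, ih hs, hr⟩

theorem Walk.exists_path {n : ℕ} {p q : Q} (h : Walk R n p q) :
    ∃ f : ℕ → Q, f 0 = p ∧ f n = q ∧ ∀ i j, i ≤ j → j ≤ n → Walk R (j - i) (f i) (f j) := by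
  induction n generalizing q with
  | zero =>
    obtain rfl : p = q := h
    refine ⟨fun _ => p, rfl, rfl, fun i j hij hj => ?_⟩
    obtain rfl : j = 0 := by omega
    simp [Walk]
  | succ n ih =>
    obtain ⟨r, hr, hq⟩ := h
    obtain ⟨f, h0, hn, hf⟩ := ih hr
    refine ⟨fun i => if i ≤ n then f i else q, by simpa using h0, by simp, fun i j hij hj => ?_⟩
    by_cases hjn : j ≤ n
    · simpa [hjn, hij.trans hjn] using hf i j hij hjn
    · obtain rfl : j = n + 1 := by omega
      by_cases hin : i ≤ n
      · have h1 := hf i n hin le_rfl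
        rw [hn] at h1
        have h2 : Walk R (n - i + 1) (f i) q := ⟨r, h1, hq⟩
        simpa [hin, Nat.sub_add_comm hin] using h2
      · obtain rfl : i = n + 1 := by omega
        simp [Walk]

theorem Walk.pow {n : ℕ} {p : Q} (h : Walk R n p p) (t : ℕ) : Walk R (t * n) p p := by
  induction t with
  | zero => simp [Walk]
  | succ t ih =>
    rw [Nat.succ_mul]
    exact ih.append h

variable [Fintype Q]

/-- Walks can be shortened without changing their length modulo `d`. -/
theorem Walk.shorten {d : ℕ} (hd : 0 < d) {b : ℕ} {p q : Q} (h : Walk R b p q) :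
    ∃ b', b' ≤ Fintype.card Q * d ∧ b' ≡ b [MOD d] ∧ Walk R b' p q := by
  induction b using Nat.strong_induction_on with
  | _ b ih =>
    rcases le_or_gt b (Fintype.card Q * d) with hb | hb
    · exact ⟨b, hb, rfl, h⟩
    · obtain ⟨f, h0, hn, hf⟩ := h.exists_path
      -- Pigeonhole on vertex and position modulo `d`: the closed piece cut out has length divisible
      -- by `d`.
      obtain ⟨i, j, hne, hij⟩ := Fintype.exists_ne_map_eq_of_card_lt
        (fun i : Fin b => ((f i, ⟨i % d, Nat.mod_lt _ hd⟩) : Q × Fin d)) (by simpa using hb)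
      wlog hlt : i < j generalizing i j
      · exact this j i hne.symm hij.symm (lt_of_le_of_ne (not_lt.1 hlt) hne.symm)
      simp only [Prod.mk.injEq, Fin.mk.injEq] at hij
      have hlt' : i.1 < j.1 := hlt
      have h1 := hf 0 i (Nat.zero_le _) i.2.le
      have h2 := hf j b j.2.le le_rfl
      rw [h0, Nat.sub_zero] at h1
      rw [hn, ← hij.1] at h2
      obtain ⟨b', hb', hmod, hw⟩ := ih (i + (b - j)) (by omega) (h1.append h2)
      refine ⟨b', hb', hmod.trans ?_, hw⟩
      have h3 : i + (b - j) ≡ j + (b - j) [MOD d] := Nat.ModEq.add_right _ hij.2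
      rwa [Nat.add_sub_cancel' j.2.le] at h3

theorem Walk.exists_cycle {b : ℕ} {p q : Q} (h : Walk R b p q) (hb : Fintype.card Q ≤ b) :
    ∃ v i d j, 0 < d ∧ d ≤ Fintype.card Q ∧ i + d + j = b ∧ Walk R i p v ∧ Walk R d v v ∧
      Walk R j v q := by
  obtain ⟨f, h0, hn, hf⟩ := h.exists_path
  obtain ⟨i, j, hne, hij⟩ := Fintype.exists_ne_map_eq_of_card_lt
    (fun i : Fin (Fintype.card Q + 1) => f i) (by simp)
  wlog hlt : i < j generalizing i j
  · exact this j i hne.symm hij.symm (lt_of_le_of_ne (not_lt.1 hlt) hne.symm)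
  have hlt' : i.1 < j.1 := hlt
  have hj := j.2
  have h1 := hf 0 i (Nat.zero_le _) (by omega)
  have h2 := hf i j hlt.le (by omega)
  have h3 := hf j b (by omega) le_rfl
  rw [h0, Nat.sub_zero] at h1
  rw [← hij] at h2 h3
  rw [hn] at h3
  exact ⟨f i, i, j - i, b - j, by omega, by omega, by omega, h1, h2, h3⟩

theorem Walk.exists_longer {m : ℕ} {p q : Q} (h : Walk R m p q) (hm : Fintype.card Q ≤ m) :
    ∃ b > m, Walk R b p q := by
  obtain ⟨v, i, d, j, hd, -, rfl, h1, h2, h3⟩ := h.exists_cycle hm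
  exact ⟨i + d + d + j, by omega, ((h1.append h2).append h2).append h3⟩

/-- If `m` is at least quadratic in the number of vertices, then a long walk whose length is
congruent to `m` modulo all possible cycle lengths yields a walk of length `m`. -/
theorem Walk.of_long {m t : ℕ} {p q : Q} (hm : 2 * Fintype.card Q ^ 2 ≤ m)
    (h : Walk R (m + t * (Fintype.card Q).factorial) p q) : Walk R m p q := by
  have hk : Fintype.card Q ≤ m := by nlinarith [Nat.le_self_pow two_ne_zero (Fintype.card Q)]
  -- The parts around a cycle of length `d` shrink modulo `d` to at most `card Q ^ 2` each. Since
  -- `d` divides the factorial, the gap to `m` is a multiple of `d`, and copies of the cycle fill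
  -- it.
  obtain ⟨v, i, d, j, hd, hdk, hb, h1, h2, h3⟩ := h.exists_cycle (by omega)
  obtain ⟨i', hi', hii, h1'⟩ := h1.shorten hd
  obtain ⟨j', hj', hjj, h3'⟩ := h3.shorten hd
  have hle : i' + j' ≤ m := by
    have : Fintype.card Q * d ≤ Fintype.card Q ^ 2 := by
      rw [pow_two]; exact Nat.mul_le_mul_left _ hdk
    omega
  have hmod : i' + j' ≡ m [MOD d] := by
    have e1 : i' + j' ≡ i + d + j [MOD d] := by
      refine (hii.add hjj).trans ?_
      have : i + d + j = i + j + d := by omega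
      rw [this]
      exact (Nat.add_modEq_right).symm
    have e2 : m + t * (Fintype.card Q).factorial ≡ m + 0 [MOD d] :=
      Nat.ModEq.add_left _ ((Nat.modEq_zero_iff_dvd).2
        ((Nat.dvd_factorial hd hdk).mul_left t))
    rw [hb] at e1
    exact e1.trans e2
  obtain ⟨c, hc⟩ := (Nat.modEq_iff_dvd' hle).1 hmod
  have hm' : m = i' + c * d + j' := by
    rw [mul_comm] at hc
    omega
  rw [hm']
  exact (h1'.append (h2.pow c)).append h3'

end Walks

/-! ### Square root bound for nondeterministic automata -/

section NFABound

variable {α Q : Type*} (P : NFA α Q)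

theorem mem_evalFrom_replicate (z : List α) (b : ℕ) (S : Set Q) (q : Q) :
    q ∈ P.evalFrom S (List.replicate b z).flatten ↔
      ∃ p ∈ S, Walk (fun p q => q ∈ P.evalFrom {p} z) b p q := by
  induction b generalizing q with
  | zero => simp [Walk]
  | succ b ih =>
    rw [List.replicate_succ', List.flatten_append, List.flatten_singleton, NFA.evalFrom_append,
      NFA.mem_evalFrom_iff_exists]
    constructor
    · rintro ⟨r, hr, hq⟩
      obtain ⟨p, hp, hw⟩ := (ih r).1 hr
      exact ⟨p, hp, r, hw, hq⟩
    · rintro ⟨p, hp, r, hw, hq⟩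
      exact ⟨r, (ih r).2 ⟨p, hp, hw⟩, hq⟩

theorem mem_accepts_replicate (x z w : List α) (b : ℕ) :
    x ++ ((List.replicate b z).flatten ++ w) ∈ P.accepts ↔
      ∃ p ∈ P.evalFrom P.start x, ∃ q, Walk (fun p q => q ∈ P.evalFrom {p} z) b p q ∧
        w ∈ P.acceptsFrom {q} := by
  rw [NFA.accepts_eq_acceptsFrom_start, NFA.append_mem_acceptsFrom, NFA.append_mem_acceptsFrom,
    NFA.mem_acceptsFrom]
  constructor
  · rintro ⟨s, hs, hse⟩
    rw [NFA.mem_evalFrom_iff_exists] at hse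
    obtain ⟨q, hq, hsq⟩ := hse
    obtain ⟨p, hp, hw⟩ := (mem_evalFrom_replicate P z b _ q).1 hq
    exact ⟨p, hp, q, hw, s, hs, hsq⟩
  · rintro ⟨p, hp, q, hw, s, hs, hsq⟩
    refine ⟨s, hs, ?_⟩
    rw [NFA.mem_evalFrom_iff_exists]
    exact ⟨q, (mem_evalFrom_replicate P z b _ q).2 ⟨p, hp, hw⟩, hsq⟩

theorem lastWindow_append (pad : α) (u v : List α) : lastWindow pad v.length (u ++ v) = v := by
  simp [lastWindow]

theorem mem_SW {pad : α} {L : Language α} {n : ℕ} {x : List α} :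
    x ∈ SW pad L n ↔ lastWindow pad n x ∈ L := Iff.rfl

theorem append_mem_SW {pad : α} {L : Language α} {n : ℕ} {u v : List α} (h : v.length = n) :
    u ++ v ∈ SW pad L n ↔ v ∈ L := by
  rw [mem_SW, ← h, lastWindow_append]

/-- For a regular language that is not a Boolean combination of suffix-testable and regular
length languages, nondeterministic sliding window automata need a number of states that is at
least of the order of the square root of the window length, along an arithmetic progression. -/
theorem exists_nfa_lowerBound [Finite α] (pad : α) {L : Language α} (hL : L.IsRegular)
    (h : L ∉ STLen α) :
    ∃ A B : ℕ, 0 < B ∧ ∀ (m : ℕ) (Q : Type) [Finite Q] (P : NFA α Q),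
      P.accepts = SW pad L (A + m * B) → m < 2 * Nat.card Q ^ 2 := by
  obtain ⟨x, y, z, w, hxy, hz, hxz, hx, hy, hpump⟩ := exists_pumping_of_notMem_STLen hL h
  refine ⟨x.length + w.length, z.length, List.length_pos_iff.2 hz, fun m Q _ P hP => ?_⟩
  have := Fintype.ofFinite Q
  rw [Nat.card_eq_fintype_card]
  by_contra! hm
  have hlen : ((List.replicate m z).flatten ++ w).length = m * z.length + w.length := by simp
  have heq : ∀ v : List α, v.length = x.length →
      (v ++ ((List.replicate m z).flatten ++ w) ∈ P.accepts ↔ v ++ w ∈ L) := by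
    intro v hv
    rw [hP, ← List.nil_append (v ++ _), append_mem_SW, hpump]
    rw [List.length_append, hlen]
    omega
  -- With more than `m` copies of `z`, the window starts with this suffix of `z` in place of `x` or
  -- `y`.
  obtain ⟨z'', z', rfl, hz'⟩ : ∃ z'' z', z = z'' ++ z' ∧ z'.length = x.length :=
    ⟨z.take (z.length - x.length), z.drop (z.length - x.length), by simp, by simp; omega⟩
  set z := z'' ++ z'
  have hgt : ∀ (v : List α) (b : ℕ), m < b →
      (v ++ ((List.replicate b z).flatten ++ w) ∈ P.accepts ↔ z' ++ w ∈ L) := by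
    intro v b hb
    obtain ⟨t, rfl⟩ : ∃ t, b = t + 1 + m := ⟨b - m - 1, by omega⟩
    have : v ++ ((List.replicate (t + 1 + m) z).flatten ++ w) =
        (v ++ ((List.replicate t z).flatten ++ z'')) ++
          (z' ++ ((List.replicate m z).flatten ++ w)) := by
      rw [List.replicate_add, List.replicate_succ']
      simp [z]
    rw [this, hP, append_mem_SW, hpump]
    rw [List.length_append, hlen]
    omega
  have hk : Fintype.card Q ≤ m := by nlinarith [Nat.le_self_pow two_ne_zero (Fintype.card Q)]
  -- If the long words are accepted, a long walk shrinks to length `m` and `y` is wrongly accepted;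
  -- otherwise the accepting walk for `x` lengthens to accept a long word wrongly.
  by_cases hzw : z' ++ w ∈ L
  · refine hy ((heq y hxy.symm).1 ?_)
    have h1 := (hgt y (m + 1 * (Fintype.card Q).factorial)
      (by have := Nat.factorial_pos (Fintype.card Q); omega)).2 hzw
    rw [mem_accepts_replicate] at h1 ⊢
    obtain ⟨p, hp, q, hw, hq⟩ := h1
    exact ⟨p, hp, q, hw.of_long hm, hq⟩
  · have h1 := (heq x rfl).2 hx
    rw [mem_accepts_replicate] at h1
    obtain ⟨p, hp, q, hw, hq⟩ := h1
    obtain ⟨b, hb, hw'⟩ := hw.exists_longer hk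
    exact hzw ((hgt x b hb).1 ((mem_accepts_replicate P x z w b).2 ⟨p, hp, q, hw', hq⟩))

end NFABound

/-! ### Complements and supports of randomized algorithms -/

namespace RandomizedAlgorithm

variable {α Q : Type*} (P : RandomizedAlgorithm α Q)

/-- The distribution of the memory state after reading `w` from the memory state `p`. -/
noncomputable def runFrom (p : Q) (w : List α) : PMF Q :=
  w.foldl (fun X a => X.bind fun p => P.step p a) (PMF.pure p)

theorem run_append (u v : List α) : P.run (u ++ v) = (P.run u).bind fun p => P.runFrom p v := by
  rw [run, List.foldl_append, ← run]
  induction v using List.reverseRecOn with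
  | nil => simp [runFrom, PMF.bind_pure]
  | append_singleton v a ih =>
    rw [List.foldl_append, ih]
    simp [runFrom, PMF.bind_bind]

theorem run_append_singleton (w : List α) (a : α) :
    P.run (w ++ [a]) = (P.run w).bind fun p => P.step p a := by
  simp [run]

/-- The complementary algorithm, which accepts when `P` rejects. -/
def compl : RandomizedAlgorithm α Q := ⟨P.init, P.step, P.acceptᶜ⟩

theorem compl_isTrueBiasedFor {P : RandomizedAlgorithm α Q} {K : Language α}
    (h : P.IsFalseBiasedFor K) : P.compl.IsTrueBiasedFor Kᶜ := by
  intro w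
  refine ⟨(h w).2, fun hw => ?_⟩
  have h1 := (h w).1 (not_not.1 hw)
  have : P.compl.rejectProb w = P.acceptProb w := by
    change (P.run w).toOuterMeasure (P.acceptᶜᶜ) = _
    rw [compl_compl]
    rfl
  rw [this, h1]

theorem rejectProb_eq_one_iff (w : List α) :
    P.rejectProb w = 1 ↔ ∀ q ∈ (P.run w).support, q ∉ P.accept :=
  PMF.toOuterMeasure_apply_eq_one_iff _ _

/-- The nondeterministic automaton of all transitions of positive probability. -/
def toNFA : NFA α Q := ⟨fun p a => (P.step p a).support, P.init.support, P.accept⟩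

theorem eval_toNFA (w : List α) : P.toNFA.eval w = (P.run w).support := by
  induction w using List.reverseRecOn with
  | nil => rfl
  | append_singleton w a ih =>
    rw [NFA.eval_append_singleton, ih, run_append_singleton, PMF.support_bind]
    rfl

/-- Under true bias a word belongs to `K` exactly when some accepting run has positive probability,
so the probabilities can be dropped. -/
theorem accepts_toNFA {P : RandomizedAlgorithm α Q} {K : Language α} (h : P.IsTrueBiasedFor K) :
    P.toNFA.accepts = K := by
  ext w
  have h1 : w ∈ P.toNFA.accepts ↔ ∃ q ∈ P.accept, q ∈ P.toNFA.eval w := Iff.rfl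
  rw [h1, eval_toNFA]
  constructor
  · rintro ⟨q, hq, hqs⟩
    by_contra hw
    exact (P.rejectProb_eq_one_iff w).1 ((h w).2 hw) q hqs hq
  · intro hw
    by_contra! hc
    have h2 := (h w).1 hw
    have h3 : P.acceptProb w = 0 :=
      (PMF.toOuterMeasure_apply_eq_zero_iff _ _).2 (Set.disjoint_left.2 fun q hq hqa => hc q hqa hq)
    rw [h3] at h2
    simp at h2

end RandomizedAlgorithm

/-! ### The index problem and the linear bound -/

section Index

/-- One-way communication lower bound for the index problem with one-sided error: if a message
`m`, distributed as `μ f`, is used to test `f i = b`, with success probability at least `2/3`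
for true tests and without error for false ones, then there are many messages. -/
theorem two_pow_le_card_of_index {Q ι : Type*} [Fintype Q] [Fintype ι] (μ : (ι → Bool) → PMF Q)
    (S : Q → ι → Bool → Prop) (h1 : ∀ f i, ∀ m ∈ (μ f).support, ¬ S m i (!f i))
    (h2 : ∀ f i, 2 / 3 ≤ (μ f).toOuterMeasure {m | S m i (f i)}) {j : ℕ}
    (hj : Fintype.card ι = 3 * j) : 2 ^ (2 * j) ≤ Fintype.card Q := by
  classical
  -- Read `S m i b` as "`m` certifies `f i = b`". The expected number of certified bits is at least
  -- `2 / 3` of `3 * j`, so some possible message certifies `2 * j` of them.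
  have hex : ∀ f, ∃ m ∈ (μ f).support, 2 * j ≤ (Finset.univ.filter fun i => S m i (f i)).card := by
    intro f
    by_contra! hc
    obtain ⟨m₀, hm₀⟩ := (μ f).support_nonempty
    have hj0 := hc m₀ hm₀
    have e1 : ∑ i, (μ f).toOuterMeasure {m | S m i (f i)} ≤ ((2 * j - 1 : ℕ) : ℝ≥0∞) := by
      simp only [PMF.toOuterMeasure_apply_fintype]
      rw [Finset.sum_comm]
      have e2 : ∀ m, ∑ i, Set.indicator {m | S m i (f i)} (μ f) m ≤
          μ f m * ((2 * j - 1 : ℕ) : ℝ≥0∞) := by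
        intro m
        have e3 : ∑ i, Set.indicator {m | S m i (f i)} (μ f) m =
            ((Finset.univ.filter fun i => S m i (f i)).card : ℝ≥0∞) * μ f m := by
          simp only [Set.indicator_apply, Set.mem_ofPred_eq]
          rw [← Finset.sum_filter, Finset.sum_const, nsmul_eq_mul]
        rw [e3, mul_comm]
        by_cases hm : μ f m = 0
        · simp [hm]
        · gcongr
          have := hc m hm
          omega
      refine (Finset.sum_le_sum fun m _ => e2 m).trans ?_
      have e5 := PMF.tsum_coe (μ f)
      rw [tsum_fintype] at e5
      rw [← Finset.sum_mul, e5, one_mul]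
    have e4 : ((2 * j : ℕ) : ℝ≥0∞) ≤ ∑ i, (μ f).toOuterMeasure {m | S m i (f i)} := by
      refine le_trans (le_of_eq ?_) (Finset.sum_le_sum fun i _ => h2 f i)
      rw [Finset.sum_const, Finset.card_univ, hj, nsmul_eq_mul]
      push_cast
      rw [mul_comm (3 : ℝ≥0∞), mul_assoc, ENNReal.mul_div_cancel (by simp) (by simp), mul_comm]
    have := Nat.cast_le.1 (e4.trans e1)
    omega
  choose g hg hgc using hex
  -- Certificates are never wrong, so all `f` sharing the message `m` agree on the bits certified
  -- for one of them; at most `j` bits stay free.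
  have hfib : ∀ m ∈ (Finset.univ : Finset Q),
      (Finset.univ.filter fun f => g f = m).card ≤ 2 ^ j := by
    intro m _
    rcases (Finset.univ.filter fun f => g f = m).eq_empty_or_nonempty with he | ⟨f₀, hf₀⟩
    · simp [he]
    · obtain rfl : g f₀ = m := by simpa using hf₀
      let T : Finset ι := Finset.univ.filter fun i => ¬ S (g f₀) i (f₀ i)
      have hT : T.card ≤ j := by
        have := Finset.card_filter_add_card_filter_not (s := (Finset.univ : Finset ι))
          (fun i => S (g f₀) i (f₀ i))
        rw [Finset.card_univ, hj] at this
        have := hgc f₀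
        simp only [T]
        omega
      calc (Finset.univ.filter fun f => g f = g f₀).card
          ≤ (Finset.univ : Finset (T → Bool)).card := by
            refine Finset.card_le_card_of_injOn (fun f i => f i) (fun _ _ => Finset.mem_univ _) ?_
            have hval : ∀ f, g f = g f₀ → ∀ i, S (g f₀) i (f₀ i) → f i = f₀ i := by
              intro f hf i hi
              by_contra hne
              refine h1 f i (g f) (hg f) ?_
              rw [hf, show (!f i) = f₀ i by revert hne; cases f i <;> cases f₀ i <;> simp]
              exact hi
            intro f hf f' hf' heq
            simp only [Finset.coe_filter, Finset.mem_univ, true_and, Set.mem_ofPred_eq] at hf hf'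
            funext i
            by_cases hi : S (g f₀) i (f₀ i)
            · rw [hval f hf i hi, hval f' hf' i hi]
            · exact congrFun heq ⟨i, by simpa [T] using hi⟩
        _ = 2 ^ T.card := by simp
        _ ≤ 2 ^ j := Nat.pow_le_pow_right two_pos hT
  have hcount := Finset.card_le_mul_card_image_of_maps_to
    (s := (Finset.univ : Finset (ι → Bool))) (fun f _ => Finset.mem_univ (g f)) _ hfib
  simp only [Finset.card_univ, Fintype.card_fun, Fintype.card_bool, hj] at hcount
  have e5 : (2 : ℕ) ^ (3 * j) = 2 ^ j * 2 ^ (2 * j) := by rw [← pow_add]; congr 1; omega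
  rw [e5] at hcount
  exact Nat.le_of_mul_le_mul_left hcount (by positivity)

theorem length_blocks {α : Type*} {X Y : List α} (h : X.length = Y.length) (bs : List Bool) :
    (blocks X Y bs).length = bs.length * X.length := by
  induction bs with
  | nil => simp [blocks]
  | cons b bs ih =>
    have : blocks X Y (b :: bs) = (if b then X else Y) ++ blocks X Y bs := rfl
    rw [this, List.length_append, ih, List.length_cons]
    split_ifs
    · ring
    · rw [← h]
      ring

theorem blocks_append {α : Type*} (X Y : List α) (bs cs : List Bool) :
    blocks X Y (bs ++ cs) = blocks X Y bs ++ blocks X Y cs :=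
  List.flatMap_append

/-- For a regular language that is not a Boolean combination of regular left ideals and regular
length languages, true-biased sliding window algorithms need exponentially many memory states,
along an arithmetic progression of window lengths. -/
theorem exists_trueBiased_lowerBound {α : Type*} (pad : α) {L : Language α} (hL : L.IsRegular)
    (h : L ∉ LILen α) :
    ∃ A B : ℕ, 0 < B ∧ ∀ (j : ℕ) (Q : Type) [Finite Q] (P : RandomizedAlgorithm α Q),
      P.IsTrueBiasedFor (SW pad L (A + j * B)) → 2 ^ (2 * j) ≤ Nat.card Q := by
  obtain ⟨X, Y, U, V, Z, hXY, hUV, ⟨X', rfl⟩, ⟨Y', rfl⟩, hmem⟩ := exists_blocks_of_notMem_LILen hL h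
  set X := X' ++ U
  set Y := Y' ++ V
  -- Nonempty blocks make the window lengths run through infinitely many values.
  have hXpos : 0 < X.length := by
    rw [List.length_pos_iff]
    intro h0
    have hU : U = [] := by
      have := congrArg List.length h0
      simp only [X, List.length_append, List.length_nil] at this
      exact List.length_eq_zero_iff.1 (by omega)
    have hV : V = [] := List.length_eq_zero_iff.1 (by rw [← hUV, hU]; rfl)
    have := hmem []
    rw [hU, hV] at this
    exact this.2 this.1
  refine ⟨U.length + Z.length, 6 * X.length, by omega, fun j Q _ P hP => ?_⟩
  have := Fintype.ofFinite Q
  rw [Nat.card_eq_fintype_card]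
  -- Appending `p + 1` blocks and `Z` pushes out everything before the last `U.length` letters of
  -- block number `p`, counted from 0; these decide membership.
  let query : ℕ → List α := fun p => blocks X Y (List.replicate (p + 1) true) ++ Z
  have hquery : ∀ (bs cs ds : List Bool) (b : Bool), bs = cs ++ b :: ds → bs.length = 6 * j →
      (blocks X Y bs ++ query cs.length ∈ SW pad L (U.length + Z.length + j * (6 * X.length)) ↔
        b = true) := by
    rintro bs cs ds b rfl hlen
    simp only [List.length_append, List.length_cons] at hlen
    set tl := ds ++ List.replicate (cs.length + 1) true with htl
    have htl' : tl.length = 6 * j := by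
      simp only [htl, List.length_append, List.length_replicate]
      omega
    have hn : (blocks X Y tl ++ Z).length = Z.length + j * (6 * X.length) := by
      rw [List.length_append, length_blocks hXY, htl']
      ring
    have hsplit : blocks X Y (cs ++ b :: ds) ++ query cs.length =
        (blocks X Y cs ++ if b then X' else Y') ++
          ((if b then U else V) ++ (blocks X Y tl ++ Z)) := by
      have : blocks X Y (b :: ds) = (if b then X else Y) ++ blocks X Y ds := rfl
      rw [htl, blocks_append, blocks_append, this]
      cases b <;> simp [query, X, Y]
    rw [hsplit, append_mem_SW]
    · cases b
      · simpa using (hmem tl).2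
      · simpa using (hmem tl).1
    · rw [List.length_append, hn]
      split_ifs
      · omega
      · omega
  -- The complemented bits are stored too: only acceptance is error-free, so a certificate for `f i
  -- = false` must be acceptance at the negated bit.
  let enc : (Fin (3 * j) → Bool) → List Bool := fun f =>
    List.ofFn f ++ List.ofFn fun i => !f i
  let idx : Fin (3 * j) → Bool → ℕ := fun i b => if b then i else 3 * j + i
  have hidx : ∀ f i b, blocks X Y (enc f) ++ query (idx i b) ∈
      SW pad L (U.length + Z.length + j * (6 * X.length)) ↔ f i = b := by
    intro f i b
    have hlen : (enc f).length = 6 * j := by simp [enc]; omega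
    have hlt : idx i b < (enc f).length := by
      rw [hlen]
      have := i.2
      simp only [idx]
      split_ifs <;> omega
    have hsp : enc f = (enc f).take (idx i b) ++ (enc f)[idx i b] :: (enc f).drop (idx i b + 1) := by
      simp
    have hq := hquery _ _ _ _ hsp hlen
    rw [List.length_take, min_eq_left hlt.le] at hq
    rw [hq]
    cases b
    · simp [enc, idx]
    · simp [enc, idx]
  -- The message is the memory state; it certifies a bit if it can still reach acceptance after the
  -- query.
  refine two_pow_le_card_of_index (fun f => P.run (blocks X Y (enc f)))
    (fun m i b => ∃ a ∈ (P.runFrom m (query (idx i b))).support, a ∈ P.accept) ?_ ?_ (by simp)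
  · rintro f i m hm ⟨a, ha, haP⟩
    have hnot : blocks X Y (enc f) ++ query (idx i (!f i)) ∉
        SW pad L (U.length + Z.length + j * (6 * X.length)) := by
      rw [hidx]; simp
    refine (P.rejectProb_eq_one_iff _).1 ((hP _).2 hnot) a ?_ haP
    rw [P.run_append, PMF.mem_support_bind_iff]
    exact ⟨m, hm, ha⟩
  · intro f i
    refine ((hP _).1 ((hidx f i (f i)).2 rfl)).trans ?_
    rw [RandomizedAlgorithm.acceptProb, P.run_append, PMF.toOuterMeasure_bind_apply,
      PMF.toOuterMeasure_apply]
    refine ENNReal.tsum_le_tsum fun m => ?_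
    classical
    rw [Set.indicator_apply]
    split_ifs with hm
    · refine mul_le_of_le_one_right' ?_
      rw [PMF.toOuterMeasure_apply, ← PMF.tsum_coe (P.runFrom m (query (idx i (f i))))]
      exact ENNReal.tsum_le_tsum fun a => Set.indicator_le_self _ _ a
    · rw [(PMF.toOuterMeasure_apply_eq_zero_iff _ _).2 (Set.disjoint_left.2 fun a ha haP =>
        hm ⟨a, ha, haP⟩), mul_zero]

end Index

end SlidingWindow

namespace SlidingWindow

/-! ### Small deterministic automata -/

section UpperBounds

variable {α : Type*}

theorem length_lastWindow (pad : α) (n : ℕ) (w : List α) : (lastWindow pad n w).length = n := by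
  unfold lastWindow
  split_ifs with h
  · simp; omega
  · simp; omega

theorem lastWindow_suffix (pad : α) (n : ℕ) (w : List α) :
    lastWindow pad n w <:+ List.replicate n pad ++ w := by
  unfold lastWindow
  split_ifs with h
  · exact (List.drop_suffix _ _).trans (List.suffix_append _ _)
  · refine ⟨List.replicate w.length pad, ?_⟩
    rw [← List.append_assoc, ← List.replicate_add]
    congr 2
    omega

theorem suffix_lastWindow_iff {pad : α} {n : ℕ} {s w : List α} (hs : s.length ≤ n) :
    s <:+ lastWindow pad n w ↔ s <:+ List.replicate n pad ++ w :=
  ⟨fun h => h.trans (lastWindow_suffix _ _ _), fun h =>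
    List.suffix_of_suffix_length_le h (lastWindow_suffix _ _ _) (by rwa [length_lastWindow])⟩

/-- The sliding window problem of `L` has deterministic automata with at most `g n ^ C` states. -/
def HasSmallDFA (g : ℕ → ℕ) (pad : α) (L : Language α) : Prop :=
  ∃ C : ℕ, ∀ n, ∃ (Q : Type) (_ : Finite Q) (M : DFA α Q),
    M.accepts = SW pad L n ∧ Nat.card Q ≤ g n ^ C

theorem exists_dfa_of_trivial {K : Language α} (h : K = ⊤ ∨ K = ⊥) :
    ∃ (Q : Type) (_ : Finite Q) (M : DFA α Q), M.accepts = K ∧ Nat.card Q = 1 := by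
  refine ⟨Unit, inferInstance, ⟨fun _ _ => (), (), {_q | K = ⊤}⟩, ?_, by simp⟩
  rcases h with rfl | rfl
  · exact Set.eq_univ_of_forall fun w => rfl
  · refine Set.eq_empty_of_forall_notMem fun w hw => ?_
    have h1 : (⊥ : Language α) = ⊤ := hw
    exact absurd (h1 ▸ Set.mem_univ [] : [] ∈ (⊥ : Language α)) (Set.notMem_empty _)

/-- The Boolean algebra of languages with small sliding window automata. -/
def smallDFA (g : ℕ → ℕ) (pad : α) : BooleanSubalgebra (Language α) := by
  have hcompl : ∀ L : Language α, HasSmallDFA g pad L → HasSmallDFA g pad Lᶜ := by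
    rintro L ⟨C, hC⟩
    refine ⟨C, fun n => ?_⟩
    obtain ⟨Q, hQ, M, hM, hcard⟩ := hC n
    exact ⟨Q, hQ, Mᶜ, by rw [DFA.accepts_compl, hM]; rfl, hcard⟩
  have hsup : ∀ L L' : Language α, HasSmallDFA g pad L → HasSmallDFA g pad L' →
      HasSmallDFA g pad (L ⊔ L') := by
    rintro L L' ⟨C, hC⟩ ⟨C', hC'⟩
    refine ⟨C + C', fun n => ?_⟩
    obtain ⟨Q, hQ, M, hM, hcard⟩ := hC n
    obtain ⟨Q', hQ', M', hM', hcard'⟩ := hC' n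
    refine ⟨Q × Q', inferInstance, M.union M', by rw [DFA.accepts_union, hM, hM']; rfl, ?_⟩
    rw [Nat.card_prod, pow_add]
    exact Nat.mul_le_mul hcard hcard'
  exact
  { carrier := {L | HasSmallDFA g pad L}
    supClosed' := fun L hL L' hL' => hsup L L' hL hL'
    infClosed' := fun L hL L' hL' => by
      have := hcompl _ (hsup _ _ (hcompl _ hL) (hcompl _ hL'))
      rwa [compl_sup, compl_compl, compl_compl] at this
    compl_mem' := fun {L} hL => hcompl L hL
    bot_mem' := ⟨0, fun n => by
      obtain ⟨Q, hQ, M, hM, hcard⟩ := exists_dfa_of_trivial (α := α) (K := ⊥) (Or.inr rfl)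
      exact ⟨Q, hQ, M, hM, by rw [hcard, pow_zero]⟩⟩ }

theorem RegularLength.mem_smallDFA (g : ℕ → ℕ) (pad : α) {L : Language α}
    (hL : L ∈ RegularLength α) : L ∈ smallDFA g pad := by
  refine ⟨0, fun n => ?_⟩
  have h : SW pad L n = ⊤ ∨ SW pad L n = ⊥ := by
    rcases hL.2 n with h | h
    · exact Or.inl (Set.eq_univ_of_forall fun w => h _ (length_lastWindow _ _ _))
    · exact Or.inr (Set.eq_empty_of_forall_notMem fun w => h _ (length_lastWindow _ _ _))
  obtain ⟨Q, hQ, M, hM, hcard⟩ := exists_dfa_of_trivial h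
  exact ⟨Q, hQ, M, hM, by rw [hcard, pow_zero]⟩

/-- If `u` fits into the window, an automaton for `Σ* u` started after `n` padding symbols already
works, as older letters are irrelevant. Otherwise no window qualifies. -/
theorem top_mul_singleton_mem_smallDFA (pad : α) (u : List α) :
    (⊤ : Language α) * ({u} : Language α) ∈ smallDFA (fun _ => 2) pad := by
  obtain ⟨σ, _, M, hM⟩ := top_mul_singleton_isRegular u
  refine ⟨Nat.card σ, fun n => ?_⟩
  rcases le_or_gt u.length n with hn | hn
  · refine ⟨σ, inferInstance, ⟨M.step, M.eval (List.replicate n pad), M.accept⟩, ?_,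
      Nat.lt_two_pow_self.le⟩
    ext w
    rw [mem_SW, mem_top_mul_singleton, suffix_lastWindow_iff hn, ← mem_top_mul_singleton, ← hM,
      DFA.mem_accepts M, eval_append]
    exact Iff.rfl
  · obtain ⟨Q, hQ, M', hM', hcard⟩ := exists_dfa_of_trivial
      (K := SW pad ((⊤ : Language α) * ({u} : Language α)) n)
      (Or.inr (Set.eq_empty_of_forall_notMem fun w hw => by
        have h1 := (mem_top_mul_singleton.1 (mem_SW.1 hw)).length_le
        rw [length_lastWindow] at h1
        omega))
    exact ⟨Q, hQ, M', hM', by rw [hcard]; exact Nat.one_le_two_pow⟩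

/-- A function on words that is compatible with appending letters yields an automaton. -/
theorem exists_dfa_of_congruence {S : Type} [Finite S] (f : List α → S) (K : Language α)
    (hstep : ∀ v w a, f v = f w → f (v ++ [a]) = f (w ++ [a]))
    (hacc : ∀ v w, f v = f w → v ∈ K → w ∈ K) : ∃ M : DFA α S, M.accepts = K := by
  classical
  -- Outside the range of `f` the transition is irrelevant and set to `s`.
  have hstep' : ∃ step : S → α → S, ∀ w a, step (f w) a = f (w ++ [a]) := by
    refine ⟨fun s a => if h : ∃ w, f w = s then f (h.choose ++ [a]) else s, fun w a => ?_⟩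
    have h : ∃ w', f w' = f w := ⟨w, rfl⟩
    dsimp only
    rw [dif_pos h]
    exact hstep _ _ _ h.choose_spec
  obtain ⟨step, hs⟩ := hstep'
  let M : DFA α S := ⟨step, f [], f '' K⟩
  refine ⟨M, ?_⟩
  have hev : ∀ w, M.eval w = f w := by
    intro w
    induction w using List.reverseRecOn with
    | nil => rfl
    | append_singleton w a ih => rw [DFA.eval_append_singleton, ih]; exact hs w a
  ext w
  rw [DFA.mem_accepts, hev]
  exact ⟨fun ⟨v, hv, hvw⟩ => hacc v w hvw hv, fun hw => ⟨w, hw, rfl⟩⟩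

/-- The least length of a suffix of `v` that leads to the state `p`, or `n + 1` if there is no
such suffix of length at most `n`. -/
noncomputable def shortestSuffix {σ : Type*} (M : DFA α σ) (n : ℕ) (v : List α) (p : σ) : ℕ :=
  sInf {i | i = n + 1 ∨ ∃ s, s <:+ v ∧ s.length = i ∧ M.eval s = p}

theorem shortestSuffix_le {σ : Type*} (M : DFA α σ) (n : ℕ) (v : List α) (p : σ) :
    shortestSuffix M n v p ≤ n + 1 :=
  Nat.sInf_le (Or.inl rfl)

theorem shortestSuffix_le_iff {σ : Type*} (M : DFA α σ) {n i : ℕ} (hi : i ≤ n) (v : List α)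
    (p : σ) :
    shortestSuffix M n v p ≤ i ↔ ∃ s, s <:+ v ∧ s.length ≤ i ∧ M.eval s = p := by
  constructor
  · intro h
    have hmem : shortestSuffix M n v p ∈
        {i | i = n + 1 ∨ ∃ s, s <:+ v ∧ s.length = i ∧ M.eval s = p} :=
      Nat.sInf_mem ⟨n + 1, Or.inl rfl⟩
    rcases hmem with h1 | ⟨s, hs, hl, hp⟩
    · omega
    · exact ⟨s, hs, hl.le.trans h, hp⟩
  · rintro ⟨s, hs, hl, hp⟩
    exact (Nat.sInf_le (Or.inr ⟨s, hs, rfl, hp⟩)).trans hl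

/-- A suffix of `v ++ [a]` is empty or extends a suffix of `v`, so the new table of lengths depends
only on the old one and `a`. -/
theorem shortestSuffix_append_singleton_le_iff {σ : Type*} (M : DFA α σ) {n i : ℕ} (hi : i ≤ n)
    (v : List α) (a : α) (p : σ) :
    shortestSuffix M n (v ++ [a]) p ≤ i ↔
      p = M.start ∨ ∃ q, M.step q a = p ∧ 1 ≤ i ∧ shortestSuffix M n v q ≤ i - 1 := by
  rw [shortestSuffix_le_iff M hi]
  constructor
  · rintro ⟨s, hs, hl, rfl⟩
    rcases List.eq_nil_or_concat s with rfl | ⟨s, b, rfl⟩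
    · exact Or.inl rfl
    · rw [List.concat_eq_append] at hs hl ⊢
      rw [List.length_append, List.length_singleton] at hl
      obtain ⟨t, ht⟩ := hs
      rw [← List.append_assoc] at ht
      obtain ⟨htv, hb⟩ := List.append_inj' ht rfl
      obtain rfl : b = a := by simpa using hb
      exact Or.inr ⟨M.eval s, by simp, by omega,
        (shortestSuffix_le_iff M (by omega) _ _).2 ⟨s, ⟨t, htv⟩, by omega, rfl⟩⟩
  · rintro (rfl | ⟨q, rfl, hi1, hq⟩)
    · exact ⟨[], List.nil_suffix, Nat.zero_le _, rfl⟩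
    · obtain ⟨s, ⟨t, rfl⟩, hl, rfl⟩ := (shortestSuffix_le_iff M (by omega) _ _).1 hq
      exact ⟨s ++ [a], ⟨t, by simp⟩, by simp; omega, by simp⟩

theorem RegularLeftIdeal.mem_smallDFA (pad : α) {L : Language α} (hL : L ∈ RegularLeftIdeal α) :
    L ∈ smallDFA (fun n => n + 2) pad := by
  obtain ⟨K, ⟨σ, _, M, rfl⟩, rfl⟩ := hL
  refine ⟨Nat.card σ, fun n => ?_⟩
  let f : List α → σ → Fin (n + 2) := fun w p =>
    ⟨shortestSuffix M n (List.replicate n pad ++ w) p,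
      Nat.lt_succ_of_le (shortestSuffix_le _ _ _ _)⟩
  have hf : ∀ v w, f v = f w → shortestSuffix M n (List.replicate n pad ++ v) =
      shortestSuffix M n (List.replicate n pad ++ w) := fun v w h =>
    funext fun p => congrArg Fin.val (congrFun h p)
  have hacc : ∀ w, w ∈ SW pad ((⊤ : Language α) * M.accepts) n ↔
      ∃ p ∈ M.accept, shortestSuffix M n (List.replicate n pad ++ w) p ≤ n := by
    intro w
    rw [mem_SW, mem_top_mul]
    constructor
    · rintro ⟨x, y, hy, hxy⟩
      have hyw : y <:+ lastWindow pad n w := ⟨x, hxy⟩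
      have hyl : y.length ≤ n := hyw.length_le.trans (length_lastWindow _ _ _).le
      exact ⟨M.eval y, hy, (shortestSuffix_le_iff M le_rfl _ _).2
        ⟨y, (suffix_lastWindow_iff hyl).1 hyw, hyl, rfl⟩⟩
    · rintro ⟨p, hp, hle⟩
      obtain ⟨y, hy, hyl, rfl⟩ := (shortestSuffix_le_iff M le_rfl _ _).1 hle
      obtain ⟨x, hx⟩ := (suffix_lastWindow_iff hyl).2 hy
      exact ⟨x, y, hp, hx⟩
  suffices h : ∃ M' : DFA α (σ → Fin (n + 2)), M'.accepts = SW pad ((⊤ : Language α) * M.accepts) n by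
    obtain ⟨M', hM'⟩ := h
    exact ⟨σ → Fin (n + 2), inferInstance, M', hM', by simp [Nat.card_fun]⟩
  refine exists_dfa_of_congruence f _ ?_ ?_
  · intro v w a hvw
    funext p
    have h1 := hf v w hvw
    -- Both values are at most `n + 1`, so equal comparisons with every `i ≤ n` force equality.
    have h2 : ∀ i ≤ n, shortestSuffix M n (List.replicate n pad ++ (v ++ [a])) p ≤ i ↔
        shortestSuffix M n (List.replicate n pad ++ (w ++ [a])) p ≤ i := by
      intro i hi
      rw [← List.append_assoc, ← List.append_assoc, shortestSuffix_append_singleton_le_iff M hi,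
        shortestSuffix_append_singleton_le_iff M hi, h1]
    refine Fin.ext ?_
    change shortestSuffix M n (List.replicate n pad ++ (v ++ [a])) p =
      shortestSuffix M n (List.replicate n pad ++ (w ++ [a])) p
    have h3 := shortestSuffix_le M n (List.replicate n pad ++ (v ++ [a])) p
    have h4 := shortestSuffix_le M n (List.replicate n pad ++ (w ++ [a])) p
    have h5 := h2 (shortestSuffix M n (List.replicate n pad ++ (v ++ [a])) p)
    have h6 := h2 (shortestSuffix M n (List.replicate n pad ++ (w ++ [a])) p)
    omega
  · intro v w hvw hv
    rw [hacc] at hv ⊢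
    rwa [← hf v w hvw]

theorem STLen.of_compl {L : Language α} (hL : Lᶜ ∈ STLen α) : L ∈ STLen α :=
  (BooleanSubalgebra.compl_mem_iff
    (L := BooleanSubalgebra.closure (SuffixTestable α ∪ RegularLength α))).1 hL

theorem STLen.hasSmallDFA (pad : α) {L : Language α} (hL : L ∈ STLen α) :
    HasSmallDFA (fun _ => 2) pad L := by
  have h : BooleanSubalgebra.closure (SuffixTestable α ∪ RegularLength α) ≤
      smallDFA (fun _ => 2) pad := by
    rw [BooleanSubalgebra.closure_le]
    rintro K (hK | hK)
    · have h1 : BooleanSubalgebra.closure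
          {K : Language α | ∃ w : List α, K = (⊤ : Language α) * ({w} : Language α)} ≤
          smallDFA (fun _ => 2) pad := by
        rw [BooleanSubalgebra.closure_le]
        rintro _ ⟨w, rfl⟩
        exact top_mul_singleton_mem_smallDFA pad w
      exact h1 hK
    · exact RegularLength.mem_smallDFA _ pad hK
  exact h hL

theorem LILen.of_compl {L : Language α} (hL : Lᶜ ∈ LILen α) : L ∈ LILen α :=
  (BooleanSubalgebra.compl_mem_iff
    (L := BooleanSubalgebra.closure (RegularLeftIdeal α ∪ RegularLength α))).1 hL

theorem LILen.hasSmallDFA (pad : α) {L : Language α} (hL : L ∈ LILen α) :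
    HasSmallDFA (fun n => n + 2) pad L := by
  have h : BooleanSubalgebra.closure (RegularLeftIdeal α ∪ RegularLength α) ≤
      smallDFA (fun n => n + 2) pad := by
    rw [BooleanSubalgebra.closure_le]
    rintro K (hK | hK)
    · exact RegularLeftIdeal.mem_smallDFA pad hK
    · exact RegularLength.mem_smallDFA _ pad hK
  exact h hL

/-- A deterministic automaton as a randomized algorithm. -/
noncomputable def RandomizedAlgorithm.ofDFA {Q : Type*} (M : DFA α Q) : RandomizedAlgorithm α Q :=
  ⟨PMF.pure M.start, fun p a => PMF.pure (M.step p a), M.accept⟩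

theorem RandomizedAlgorithm.run_ofDFA {Q : Type*} (M : DFA α Q) (w : List α) :
    (ofDFA M).run w = PMF.pure (M.eval w) := by
  induction w using List.reverseRecOn with
  | nil => rfl
  | append_singleton w a ih =>
    rw [run_append_singleton, ih, PMF.pure_bind, DFA.eval_append_singleton]
    rfl

theorem RandomizedAlgorithm.ofDFA_exact {Q : Type*} (M : DFA α Q) (w : List α) :
    (w ∈ M.accepts → (ofDFA M).acceptProb w = 1) ∧ (w ∉ M.accepts → (ofDFA M).rejectProb w = 1) := by
  rw [acceptProb, rejectProb, run_ofDFA, PMF.toOuterMeasure_apply_eq_one_iff,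
    PMF.toOuterMeasure_apply_eq_one_iff, PMF.support_pure, Set.singleton_subset_iff,
    Set.singleton_subset_iff]
  exact ⟨id, id⟩

theorem two_thirds_le_one : (2 / 3 : ℝ≥0∞) ≤ 1 :=
  ENNReal.div_le_of_le_mul (by norm_num)

theorem HasSmallDFA.exists_complexity_le {g : ℕ → ℕ} {pad : α} {L : Language α}
    (h : HasSmallDFA g pad L) : ∃ C : ℕ, ∀ n, 0 < g n →
      trueBiasedComplexity pad L n ≤ ENNReal.ofReal (C * Real.logb 2 (g n)) ∧
      falseBiasedComplexity pad L n ≤ ENNReal.ofReal (C * Real.logb 2 (g n)) := by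
  obtain ⟨C, hC⟩ := h
  refine ⟨C, fun n hg => ?_⟩
  obtain ⟨Q, hQ, M, hM, hcard⟩ := hC n
  have hne : Nonempty Q := ⟨M.start⟩
  have hspace : space Q ≤ ENNReal.ofReal (C * Real.logb 2 (g n)) := by
    rw [space, if_pos hQ]
    refine ENNReal.ofReal_le_ofReal ?_
    rw [← Real.logb_pow]
    refine Real.logb_le_logb_of_le one_lt_two (by exact_mod_cast Nat.card_pos) ?_
    exact_mod_cast hcard
  have hex := RandomizedAlgorithm.ofDFA_exact M
  rw [hM] at hex
  constructor
  · refine (iInf_le_of_le Q (iInf_le_of_le (RandomizedAlgorithm.ofDFA M)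
      (iInf_le _ fun w => ⟨fun hw => ?_, (hex w).2⟩))).trans hspace
    rw [(hex w).1 hw]
    exact two_thirds_le_one
  · refine (iInf_le_of_le Q (iInf_le_of_le (RandomizedAlgorithm.ofDFA M)
      (iInf_le _ fun w => ⟨(hex w).1, fun hw => ?_⟩))).trans hspace
    rw [(hex w).2 hw]
    exact two_thirds_le_one

end UpperBounds

/-! ### Asymptotic lower bounds -/

section LowerBounds

variable {α : Type*}

theorem trueBiasedComplexity_compl_le (pad : α) (L : Language α) (n : ℕ) :
    trueBiasedComplexity pad Lᶜ n ≤ falseBiasedComplexity pad L n :=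
  le_iInf fun Q => le_iInf fun P => le_iInf fun hP =>
    iInf_le_of_le Q (iInf_le_of_le P.compl
      (iInf_le_of_le (RandomizedAlgorithm.compl_isTrueBiasedFor hP) le_rfl))

theorem BigOmegaInf.mono {f f' : ℕ → ℝ≥0∞} {g : ℕ → ℝ} (h : BigOmegaInf f g)
    (hf : ∀ n, f n ≤ f' n) :
    BigOmegaInf f' g := by
  obtain ⟨c, hc, hfr⟩ := h
  exact ⟨c, hc, hfr.mono fun n hn => hn.trans (hf n)⟩

theorem le_trueBiasedComplexity {pad : α} {L : Language α} {n : ℕ} {r : ℝ}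
    (h : ∀ (Q : Type) [Finite Q] [Nonempty Q] (P : RandomizedAlgorithm α Q),
      P.IsTrueBiasedFor (SW pad L n) → r ≤ Real.logb 2 (Nat.card Q)) :
    ENNReal.ofReal r ≤ trueBiasedComplexity pad L n := by
  refine le_iInf fun Q => le_iInf fun P => le_iInf fun hP => ?_
  rw [space]
  split_ifs with hQ
  · have : Nonempty Q := ⟨P.init.support_nonempty.some⟩
    exact ENNReal.ofReal_le_ofReal (h Q P hP)
  · exact le_top

theorem frequently_nfa_lowerBound [Finite α] (pad : α) {L : Language α} (hL : L.IsRegular)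
    (h : L ∉ STLen α) :
    ∃ D : ℕ, 0 < D ∧ ∃ᶠ n : ℕ in atTop, ∀ (Q : Type) [Finite Q] (P : NFA α Q),
      P.accepts = SW pad L n → n ≤ D * Nat.card Q ^ 2 := by
  obtain ⟨A, B, hB, hAB⟩ := exists_nfa_lowerBound pad hL h
  refine ⟨2 * (A + B), by omega, frequently_atTop.2 fun a => ⟨A + (a + 1) * B, by nlinarith, ?_⟩⟩
  intro Q _ P hP
  have h1 := hAB (a + 1) Q P hP
  calc A + (a + 1) * B ≤ (A + B) * (a + 1) := by nlinarith
    _ ≤ (A + B) * (2 * Nat.card Q ^ 2) := Nat.mul_le_mul_left _ h1.le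
    _ = 2 * (A + B) * Nat.card Q ^ 2 := by ring

theorem trueBiased_log_lowerBound [Finite α] (pad : α) {L : Language α} (hL : L.IsRegular)
    (h : L ∉ STLen α) :
    BigOmegaInf (trueBiasedComplexity pad L) (fun n => Real.logb 2 n) := by
  obtain ⟨D, hD, hfr⟩ := frequently_nfa_lowerBound pad hL h
  -- From `n ≤ D k ^ 2`, `log n ≤ log D + 2 log k`; once `n ≥ D ^ 2`, `log D` is at most half of
  -- `log n`, leaving `log k ≥ (log n) / 4`.
  refine ⟨1 / 4, by norm_num, (hfr.and_eventually (eventually_ge_atTop (D ^ 2))).mono ?_⟩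
  rintro n ⟨hn, hDn⟩
  refine le_trueBiasedComplexity fun Q _ _ P hP => ?_
  have h1 := hn Q P.toNFA (RandomizedAlgorithm.accepts_toNFA hP)
  have hk : (0 : ℝ) < Nat.card Q := by exact_mod_cast Nat.card_pos
  have hD' : (0 : ℝ) < D := by exact_mod_cast hD
  have hn0 : (0 : ℝ) < n := by exact_mod_cast (pow_pos hD 2).trans_le hDn
  have h2 : Real.logb 2 n ≤ Real.logb 2 D + 2 * Real.logb 2 (Nat.card Q) := by
    have h3 : Real.logb 2 n ≤ Real.logb 2 (D * (Nat.card Q : ℝ) ^ 2) :=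
      Real.logb_le_logb_of_le one_lt_two hn0 (by exact_mod_cast h1)
    rw [Real.logb_mul hD'.ne' (by positivity), Real.logb_pow] at h3
    exact_mod_cast h3
  have h4 : 2 * Real.logb 2 D ≤ Real.logb 2 n := by
    have h5 : Real.logb 2 ((D : ℝ) ^ 2) ≤ Real.logb 2 n :=
      Real.logb_le_logb_of_le one_lt_two (by positivity) (by exact_mod_cast hDn)
    rw [Real.logb_pow] at h5
    exact_mod_cast h5
  linarith

theorem trueBiased_linear_lowerBound (pad : α) {L : Language α} (hL : L.IsRegular)
    (h : L ∉ LILen α) : BigOmegaInf (trueBiasedComplexity pad L) (fun n => n) := by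
  obtain ⟨A, B, hB, hAB⟩ := exists_trueBiased_lowerBound pad hL h
  have hpos : (0 : ℝ) < A + B := by
    have : (0 : ℝ) < B := by exact_mod_cast hB
    positivity
  -- `A + (a + 1) * B ≤ (a + 1) * (A + B)`, while the space is at least `2 * (a + 1)`.
  refine ⟨1 / (A + B), by positivity, frequently_atTop.2 fun a =>
    ⟨A + (a + 1) * B, by nlinarith, le_trueBiasedComplexity fun Q _ _ P hP => ?_⟩⟩
  have h1 : ((2 : ℝ) ^ (2 * (a + 1))) ≤ Nat.card Q := by exact_mod_cast hAB (a + 1) Q P hP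
  have h2 : ((2 * (a + 1) : ℕ) : ℝ) ≤ Real.logb 2 (Nat.card Q) := by
    rw [Real.le_logb_iff_rpow_le one_lt_two (by exact_mod_cast Nat.card_pos), Real.rpow_natCast]
    exact h1
  refine le_trans ?_ h2
  rw [one_div, inv_mul_le_iff₀ hpos]
  push_cast
  have hA : (0 : ℝ) ≤ A := Nat.cast_nonneg _
  have hB' : (0 : ℝ) ≤ B := Nat.cast_nonneg _
  have ha : (0 : ℝ) ≤ a := Nat.cast_nonneg _
  nlinarith [mul_nonneg hA ha, mul_nonneg hB' ha]

end LowerBounds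

end SlidingWindow

theorem mainTheorem5 {α : Type*} [Finite α] (pad : α) (L : Language α) (hL : L.IsRegular) :
    (L ∈ SlidingWindow.STLen α →
      SlidingWindow.BigO (SlidingWindow.trueBiasedComplexity pad L) (fun _ => 1) ∧
      SlidingWindow.BigO (SlidingWindow.falseBiasedComplexity pad L) (fun _ => 1)) ∧
    (L ∉ SlidingWindow.STLen α →
      SlidingWindow.BigOmegaInf (SlidingWindow.trueBiasedComplexity pad L)
        (fun n => Real.logb 2 n) ∧
      SlidingWindow.BigOmegaInf (SlidingWindow.falseBiasedComplexity pad L)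
        (fun n => Real.logb 2 n)) ∧
    (L ∈ SlidingWindow.LILen α →
      SlidingWindow.BigO (SlidingWindow.trueBiasedComplexity pad L)
        (fun n => Real.logb 2 n) ∧
      SlidingWindow.BigO (SlidingWindow.falseBiasedComplexity pad L)
        (fun n => Real.logb 2 n)) ∧
    (L ∉ SlidingWindow.LILen α →
      SlidingWindow.BigOmegaInf (SlidingWindow.trueBiasedComplexity pad L) (fun n => n) ∧
      SlidingWindow.BigOmegaInf (SlidingWindow.falseBiasedComplexity pad L) (fun n => n)) ∧
    (L ∉ SlidingWindow.STLen α →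
      ∃ c : ℝ, 0 < c ∧ ∃ᶠ n : ℕ in Filter.atTop,
        ∀ (Q : Type) [Finite Q] (P : NFA α Q), P.accepts = SlidingWindow.SW pad L n →
          c * √(n : ℝ) ≤ (Nat.card Q : ℝ)) := by
  open SlidingWindow in
  refine ⟨fun h => ?_, fun h => ⟨trueBiased_log_lowerBound pad hL h, ?_⟩, fun h => ?_,
    fun h => ⟨trueBiased_linear_lowerBound pad hL h, ?_⟩, fun h => ?_⟩
  · obtain ⟨C, hC⟩ := (STLen.hasSmallDFA pad h).exists_complexity_le
    have h1 : (C : ℝ) * Real.logb 2 ((2 : ℕ) : ℝ) = C * 1 := by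
      rw [Nat.cast_ofNat, Real.logb_self_eq_one one_lt_two]
    simp only [h1] at hC
    exact ⟨⟨C, Eventually.of_forall fun n => (hC n two_pos).1⟩,
      ⟨C, Eventually.of_forall fun n => (hC n two_pos).2⟩⟩
  · exact (trueBiased_log_lowerBound pad hL.compl
      (fun hc => h (STLen.of_compl hc))).mono
      (trueBiasedComplexity_compl_le pad L)
  · obtain ⟨C, hC⟩ := (LILen.hasSmallDFA pad h).exists_complexity_le
    -- `n + 2 ≤ n ^ 2` for `n ≥ 2`, which costs a factor 2 in the constant.
    have h1 : ∀ n : ℕ, 2 ≤ n → ENNReal.ofReal (C * Real.logb 2 ((n + 2 : ℕ) : ℝ)) ≤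
        ENNReal.ofReal (C * 2 * Real.logb 2 n) := by
      intro n hn
      refine ENNReal.ofReal_le_ofReal ?_
      rw [mul_assoc]
      refine mul_le_mul_of_nonneg_left ?_ (Nat.cast_nonneg _)
      have h2 : Real.logb 2 ((n + 2 : ℕ) : ℝ) ≤ Real.logb 2 ((n : ℝ) ^ 2) :=
        Real.logb_le_logb_of_le one_lt_two (by positivity)
          (by exact_mod_cast (by nlinarith : n + 2 ≤ n ^ 2))
      rw [Real.logb_pow] at h2
      exact_mod_cast h2
    exact ⟨⟨C * 2, (eventually_ge_atTop 2).mono fun n hn =>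
        (hC n (Nat.succ_pos _)).1.trans (h1 n hn)⟩,
      ⟨C * 2, (eventually_ge_atTop 2).mono fun n hn =>
        (hC n (Nat.succ_pos _)).2.trans (h1 n hn)⟩⟩
  · exact (trueBiased_linear_lowerBound pad hL.compl
      (fun hc => h (LILen.of_compl hc))).mono
      (trueBiasedComplexity_compl_le pad L)
  · obtain ⟨D, hD, hfr⟩ := frequently_nfa_lowerBound pad hL h
    have hD' : (0 : ℝ) < D := by exact_mod_cast hD
    refine ⟨1 / √(D : ℝ), by positivity, hfr.mono fun n hn Q _ P hP => ?_⟩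
    rw [one_div, inv_mul_le_iff₀ (by positivity), ← Real.sqrt_sq (Nat.cast_nonneg (Nat.card Q)),
      ← Real.sqrt_mul hD'.le]
    exact Real.sqrt_le_sqrt (by exact_mod_cast hn Q P hP)
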